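/- Let $n\ge 2$, let $f:\mathbb{R}^{n+1}\to\mathbb{R}$ be a smooth function with regular value $0$ (that is, $\nabla f(x)\neq 0$ whenever $f(x)=0$), and let $M=f^{-1}(0)$ carry the Riemannian metric induced from $\mathbb{R}^{n+1}$. For $x\in M$ let $T_xM=\{v\in\mathbb{R}^{n+1}: v\cdot\nabla f(x)=0\}$, let $\mathrm{Hess}(f)_x$ be the Hessian of $f$ in $\mathbb{R}^{n+1}$, and for linearly independent $v,w\in T_xM$ let $K_M(v,w)$ be the (intrinsic Riemannian) sectional curvature of $M$ at $x$ of the plane spanned by $v,w$, computed from the induced metric in a local parametrization of $M$; it exists and does not depend on the parametrization. 1. For every $x\in M$ and all orthonormal $v,w\in T_xM$, $$K_M(v,w)=\frac{\mathrm{Hess}(f)_x(v,v)\,\mathrm{Hess}(f)_x(w,w)-\mathrm{Hess}(f)_x(v,w)^2}{\|\nabla f(x)\|^2}.$$ 2. For every $x\in M$, the sectional curvatures of all planes $\sigma\subset T_xM$ are positive if and only if the restriction of $\mathrm{Hess}(f)_x$ to $T_xM$ is either positive definite or negative definite. Hence $M$ has positive sectional curvature everywhere if and only if, at every $x\in M$,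 the restriction of $\mathrm{Hess}(f)_x$ to $T_xM$ is positive definite or negative definite. 3. If moreover $M$ is connected, then $M$ has positive sectional curvature everywhere if and only if the restriction of $\mathrm{Hess}(f)_x$ to $T_xM$ is positive definite for all $x\in M$ or negative definite for all $x\in M$. -/

import Mathlib

open scoped ContDiff RealInnerProductSpace

/-! ## Riemannian curvature of a metric given in coordinates -/

/-- The partial derivative `∂h/∂uᵢ` of a real function of `n` variables. -/
noncomputable def partialDeriv {n : ℕ} (i : Fin n) (h : EuclideanSpace ℝ (Fin n) → ℝ)
    (u : EuclideanSpace ℝ (Fin n)) : ℝ :=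
  fderiv ℝ h u (EuclideanSpace.single i 1)

/-- The Christoffel symbol `Γᵏᵢⱼ = ½ ∑ₗ gᵏˡ (∂ᵢ gⱼₗ + ∂ⱼ gᵢₗ - ∂ₗ gᵢⱼ)` of the Levi-Civita
connection of the metric `g = (gᵢⱼ)`. -/
noncomputable def christoffel {n : ℕ}
    (g : EuclideanSpace ℝ (Fin n) → Matrix (Fin n) (Fin n) ℝ)
    (k i j : Fin n) (u : EuclideanSpace ℝ (Fin n)) : ℝ :=
  (1 / 2 : ℝ) * ∑ l, (g u)⁻¹ k l *
    (partialDeriv i (fun y => g y j l) u + partialDeriv j (fun y => g y i l) u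
      - partialDeriv l (fun y => g y i j) u)

/-- The component `Rˡᵢⱼₖ` of the Riemann curvature tensor of `g`, with the convention
`R(∂ᵢ, ∂ⱼ) ∂ₖ = ∇ᵢ ∇ⱼ ∂ₖ - ∇ⱼ ∇ᵢ ∂ₖ = ∑ₗ Rˡᵢⱼₖ ∂ₗ`. -/
noncomputable def riemannTensor {n : ℕ}
    (g : EuclideanSpace ℝ (Fin n) → Matrix (Fin n) (Fin n) ℝ)
    (l i j k : Fin n) (u : EuclideanSpace ℝ (Fin n)) : ℝ :=
  partialDeriv i (christoffel g l j k) u - partialDeriv j (christoffel g l i k) u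
    + ∑ m, (christoffel g l i m u * christoffel g m j k u
      - christoffel g l j m u * christoffel g m i k u)

/-- The value `g_u(a, b) = ∑ gᵢⱼ(u) aᵢ bⱼ`. -/
noncomputable def metricValue {n : ℕ}
    (g : EuclideanSpace ℝ (Fin n) → Matrix (Fin n) (Fin n) ℝ)
    (u a b : EuclideanSpace ℝ (Fin n)) : ℝ :=
  ∑ i, ∑ j, g u i j * a i * b j

/-- The vector `R_u(a, b) c`, by its components. -/
noncomputable def curvatureVector {n : ℕ}
    (g : EuclideanSpace ℝ (Fin n) → Matrix (Fin n) (Fin n) ℝ)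
    (u a b c : EuclideanSpace ℝ (Fin n)) : EuclideanSpace ℝ (Fin n) :=
  WithLp.toLp 2 fun l => ∑ i, ∑ j, ∑ k, riemannTensor g l i j k u * a i * b j * c k

/-- The sectional curvature at `u` of the plane spanned by `a` and `b`, for the metric `g`:
`g(R(a, b) b, a) / (g(a, a) g(b, b) - g(a, b)²)`. -/
noncomputable def metricSectionalCurvature {n : ℕ}
    (g : EuclideanSpace ℝ (Fin n) → Matrix (Fin n) (Fin n) ℝ)
    (u a b : EuclideanSpace ℝ (Fin n)) : ℝ :=
  metricValue g u (curvatureVector g u a b b) a /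
    (metricValue g u a a * metricValue g u b b - metricValue g u a b ^ 2)

/-! ## Hypersurfaces of Euclidean space -/

/-- `φ : U → ℝⁿ⁺¹` is a local parametrization of the hypersurface `M`: a smooth immersion of an
open set `U ⊆ ℝⁿ` which is a homeomorphism onto a relatively open subset of `M`. -/
structure IsLocalParametrization {n : ℕ} (M : Set (EuclideanSpace ℝ (Fin (n + 1))))
    (U : Set (EuclideanSpace ℝ (Fin n)))
    (φ : EuclideanSpace ℝ (Fin n) → EuclideanSpace ℝ (Fin (n + 1))) : Prop where
  isOpen : IsOpen U
  smooth : ContDiffOn ℝ ∞ φ U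
  immersion : ∀ u ∈ U, Function.Injective (fderiv ℝ φ u)
  isEmbedding : Topology.IsEmbedding (U.domRestrict φ)
  image_eq : ∃ V, IsOpen V ∧ φ '' U = M ∩ V

/-- The metric that `φ` induces from the Euclidean inner product, `gᵢⱼ = ⟨∂ᵢφ, ∂ⱼφ⟩`. -/
noncomputable def inducedMetric {n : ℕ}
    (φ : EuclideanSpace ℝ (Fin n) → EuclideanSpace ℝ (Fin (n + 1)))
    (u : EuclideanSpace ℝ (Fin n)) : Matrix (Fin n) (Fin n) ℝ :=
  Matrix.of fun i j => ⟪fderiv ℝ φ u (EuclideanSpace.single i 1),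
    fderiv ℝ φ u (EuclideanSpace.single j 1)⟫

/-- `K` is the sectional curvature of `M` (with the metric induced from `ℝⁿ⁺¹`) at `x`, for the
plane spanned by the tangent vectors `v`, `w`, as computed in some local parametrization of `M`
around `x`. -/
def HasSectionalCurvature {n : ℕ} (M : Set (EuclideanSpace ℝ (Fin (n + 1))))
    (x v w : EuclideanSpace ℝ (Fin (n + 1))) (K : ℝ) : Prop :=
  ∃ (U : Set (EuclideanSpace ℝ (Fin n)))
    (φ : EuclideanSpace ℝ (Fin n) → EuclideanSpace ℝ (Fin (n + 1)))
    (p a b : EuclideanSpace ℝ (Fin n)),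
    IsLocalParametrization M U φ ∧ p ∈ U ∧ φ p = x ∧
      fderiv ℝ φ p a = v ∧ fderiv ℝ φ p b = w ∧
      K = metricSectionalCurvature (inducedMetric φ) p a b

open Classical in
/-- The sectional curvature `K_M(v, w)` at `x ∈ M`, computed in any local parametrization
(and `0` if there is no local parametrization around `x` with `v`, `w` tangent to it). -/
noncomputable def sectionalCurvature {n : ℕ} (M : Set (EuclideanSpace ℝ (Fin (n + 1))))
    (x v w : EuclideanSpace ℝ (Fin (n + 1))) : ℝ :=
  if h : ∃ K, HasSectionalCurvature M x v w K then h.choose else 0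

/-! ## Regular level sets -/

/-- The zero set `M = f⁻¹(0)`. -/
def zeroLevel {n : ℕ} (f : EuclideanSpace ℝ (Fin (n + 1)) → ℝ) :
    Set (EuclideanSpace ℝ (Fin (n + 1))) :=
  {x | f x = 0}

/-- The tangent space `T_x M = {v : v · ∇f(x) = 0}` of a regular level set of `f`. -/
noncomputable def levelTangent {n : ℕ} (f : EuclideanSpace ℝ (Fin (n + 1)) → ℝ)
    (x : EuclideanSpace ℝ (Fin (n + 1))) : Submodule ℝ (EuclideanSpace ℝ (Fin (n + 1))) :=
  (Submodule.span ℝ {gradient f x})ᗮ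

/-- The Hessian `Hess(f)_x(v, w)`, the second derivative of `f` in `ℝⁿ⁺¹`. -/
noncomputable def hess {n : ℕ} (f : EuclideanSpace ℝ (Fin (n + 1)) → ℝ)
    (x v w : EuclideanSpace ℝ (Fin (n + 1))) : ℝ :=
  fderiv ℝ (fderiv ℝ f) x v w

/-- `Hess(f)_x` is positive definite on `T_x M`. -/
def HessPosDefAt {n : ℕ} (f : EuclideanSpace ℝ (Fin (n + 1)) → ℝ)
    (x : EuclideanSpace ℝ (Fin (n + 1))) : Prop :=
  ∀ v ∈ levelTangent f x, v ≠ 0 → 0 < hess f x v v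

/-- `Hess(f)_x` is negative definite on `T_x M`. -/
def HessNegDefAt {n : ℕ} (f : EuclideanSpace ℝ (Fin (n + 1)) → ℝ)
    (x : EuclideanSpace ℝ (Fin (n + 1))) : Prop :=
  ∀ v ∈ levelTangent f x, v ≠ 0 → hess f x v v < 0

/-- The sectional curvatures of `M = f⁻¹(0)` at `x` are positive for all planes in `T_x M`, a
plane being given by any basis `v, w` of it. -/
def PosSectionalCurvatureAt {n : ℕ} (f : EuclideanSpace ℝ (Fin (n + 1)) → ℝ)
    (x : EuclideanSpace ℝ (Fin (n + 1))) : Prop :=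
  ∀ v ∈ levelTangent f x, ∀ w ∈ levelTangent f x, LinearIndependent ℝ ![v, w] →
    0 < sectionalCurvature (zeroLevel f) x v w

/-!
The sectional curvature of a regular level set is read off from the Gauss equation.

For an immersion `φ` of an open subset of `ℝⁿ`, the formula for the Christoffel symbols of the
induced metric says exactly that `∑ₖ Γᵏᵢⱼ ∂ₖφ` is the tangential part of `∂ᵢ∂ⱼφ`; let `II(∂ᵢ, ∂ⱼ)`
be the normal part (`secondFundamental`). Differentiating `⟨∂ⱼ∂ₖφ, ∂ₘφ⟩ = ∑ₗ Γˡⱼₖ gₗₘ` and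
antisymmetrizing, with third derivatives of `φ` symmetric, gives the Gauss equation
`∑ₗ gₗₘ Rˡᵢⱼₖ = ⟨II(∂ⱼ, ∂ₖ), II(∂ᵢ, ∂ₘ)⟩ - ⟨II(∂ᵢ, ∂ₖ), II(∂ⱼ, ∂ₘ)⟩` (`gauss_equation`,
`metricValue_curvatureVector`).

If `φ` parametrizes `f⁻¹(0)`, then `II` is a multiple of `∇f`, and differentiating
`⟨∇f, ∂ⱼφ⟩ = 0` identifies it as `-Hess(f)(·, ·) ∇f / ‖∇f‖²`
(`IsLocalParametrization.secondFundamentalForm_eq`). This yields a formula for the sectional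
curvature that does not mention `φ` (`HasSectionalCurvature.eq_hess`), hence independence of the
parametrization; a parametrization exists by the inverse function theorem
(`exists_isLocalParametrization`).

Positivity of all sectional curvatures at a point thus means that `Hess(f)` has positive Gram
determinant on every tangent plane. In dimension at least two this is definiteness of the
restricted Hessian (`forall_linearIndependent_mul_sub_sq_pos_iff`). Its sign is that of the trace
of the restriction, a continuous function without zeros, so it is constant on a connected
hypersurface (`forall_hessPosDefAt_or_forall_hessNegDefAt`).
-/

/-! ### Differentiability of matrix inverses -/

lemma DifferentiableAt.matrix_det {E ι : Type*} [NormedAddCommGroup E] [NormedSpace ℝ E]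
    [Fintype ι] [DecidableEq ι] {A : E → Matrix ι ι ℝ} {x : E}
    (hA : ∀ i j, DifferentiableAt ℝ (fun u => A u i j) x) :
    DifferentiableAt ℝ (fun u => (A u).det) x := by
  simp only [Matrix.det_apply']
  refine DifferentiableAt.fun_sum fun σ _ => DifferentiableAt.const_mul ?_ _
  exact (HasFDerivAt.finsetProd fun i _ => (hA (σ i) i).hasFDerivAt).differentiableAt

lemma DifferentiableAt.matrix_inv_apply {E ι : Type*} [NormedAddCommGroup E] [NormedSpace ℝ E]
    [Fintype ι] [DecidableEq ι] {A : E → Matrix ι ι ℝ} {x : E}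
    (hA : ∀ i j, DifferentiableAt ℝ (fun u => A u i j) x) (hdet : (A x).det ≠ 0) (i j : ι) :
    DifferentiableAt ℝ (fun u => (A u)⁻¹ i j) x := by
  simp only [Matrix.inv_def, Matrix.smul_apply, smul_eq_mul, Ring.inverse_eq_inv,
    Matrix.adjugate_apply]
  refine ((DifferentiableAt.matrix_det hA).inv hdet).mul (DifferentiableAt.matrix_det fun k l => ?_)
  by_cases h : k = j
  · subst h
    simp
  · simpa [Matrix.updateRow_ne h] using hA k l

/-! ### Coordinate derivatives of vector-valued maps -/

/-- The partial derivative `∂h/∂uᵢ` of a vector-valued map. -/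
noncomputable def coordDeriv {n : ℕ} {F : Type*} [NormedAddCommGroup F] [NormedSpace ℝ F]
    (i : Fin n) (h : EuclideanSpace ℝ (Fin n) → F) (u : EuclideanSpace ℝ (Fin n)) : F :=
  fderiv ℝ h u (EuclideanSpace.single i 1)

section CoordDeriv

variable {n : ℕ} {F : Type*} [NormedAddCommGroup F]

lemma ContDiffOn.coordDeriv [NormedSpace ℝ F] {U : Set (EuclideanSpace ℝ (Fin n))}
    {h : EuclideanSpace ℝ (Fin n) → F} (hh : ContDiffOn ℝ ∞ h U) (hU : IsOpen U) (i : Fin n) :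
    ContDiffOn ℝ ∞ (coordDeriv i h) U :=
  (hh.fderiv_of_isOpen hU (by simp)).clm_apply contDiffOn_const

lemma ContDiffOn.differentiableAt_of_isOpen [NormedSpace ℝ F]
    {U : Set (EuclideanSpace ℝ (Fin n))}
    {h : EuclideanSpace ℝ (Fin n) → F} (hh : ContDiffOn ℝ ∞ h U) (hU : IsOpen U)
    {u : EuclideanSpace ℝ (Fin n)} (hu : u ∈ U) : DifferentiableAt ℝ h u :=
  (hh.contDiffAt (hU.mem_nhds hu)).differentiableAt (by simp)

lemma coordDeriv_congr [NormedSpace ℝ F] {U : Set (EuclideanSpace ℝ (Fin n))} (hU : IsOpen U)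
    {h h' : EuclideanSpace ℝ (Fin n) → F} (hh : ∀ u ∈ U, h u = h' u) (i : Fin n)
    {u : EuclideanSpace ℝ (Fin n)} (hu : u ∈ U) : coordDeriv i h u = coordDeriv i h' u := by
  have : h =ᶠ[nhds u] h' := Filter.mem_of_superset (hU.mem_nhds hu) hh
  rw [coordDeriv, coordDeriv, this.fderiv_eq]

lemma coordDeriv_coordDeriv_apply [NormedSpace ℝ F] {U : Set (EuclideanSpace ℝ (Fin n))}
    (hU : IsOpen U) {h : EuclideanSpace ℝ (Fin n) → F} (hh : ContDiffOn ℝ ∞ h U) (i j : Fin n)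
    {u : EuclideanSpace ℝ (Fin n)} (hu : u ∈ U) :
    coordDeriv i (coordDeriv j h) u =
      fderiv ℝ (fderiv ℝ h) u (EuclideanSpace.single i 1) (EuclideanSpace.single j 1) := by
  have hd : DifferentiableAt ℝ (fderiv ℝ h) u :=
    ((hh.fderiv_of_isOpen (m := ∞) hU (by simp)).contDiffAt
      (hU.mem_nhds hu)).differentiableAt (by simp)
  change fderiv ℝ (fun y => fderiv ℝ h y (EuclideanSpace.single j 1)) u _ = _
  rw [fderiv_clm_apply hd (differentiableAt_const _)]
  simp

lemma coordDeriv_comm [NormedSpace ℝ F] {U : Set (EuclideanSpace ℝ (Fin n))}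
    (hU : IsOpen U) {h : EuclideanSpace ℝ (Fin n) → F} (hh : ContDiffOn ℝ ∞ h U) (i j : Fin n)
    {u : EuclideanSpace ℝ (Fin n)} (hu : u ∈ U) :
    coordDeriv i (coordDeriv j h) u = coordDeriv j (coordDeriv i h) u := by
  rw [coordDeriv_coordDeriv_apply hU hh i j hu, coordDeriv_coordDeriv_apply hU hh j i hu]
  exact (hh.contDiffAt (hU.mem_nhds hu)).isSymmSndFDerivAt
    (by rw [minSmoothness_of_isRCLikeNormedField]; exact WithTop.coe_le_coe.2 (le_top (a := (2 : ℕ∞)))) _ _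

lemma coordDeriv_inner [InnerProductSpace ℝ F] {h k : EuclideanSpace ℝ (Fin n) → F}
    {u : EuclideanSpace ℝ (Fin n)} (hh : DifferentiableAt ℝ h u) (hk : DifferentiableAt ℝ k u)
    (i : Fin n) :
    coordDeriv i (fun y => ⟪h y, k y⟫) u = ⟪h u, coordDeriv i k u⟫ + ⟪coordDeriv i h u, k u⟫ :=
  fderiv_inner_apply ℝ hh hk _

lemma fderiv_apply_eq_sum_coordDeriv [NormedSpace ℝ F] (h : EuclideanSpace ℝ (Fin n) → F)
    (u a : EuclideanSpace ℝ (Fin n)) : fderiv ℝ h u a = ∑ i, a i • coordDeriv i h u := by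
  conv_lhs => rw [← (EuclideanSpace.basisFun (Fin n) ℝ).sum_repr a]
  simp [coordDeriv]

end CoordDeriv

/-! ### The Gauss equation for an immersion -/

/-- The normal part `∂ᵢ∂ⱼφ - ∑ₖ Γᵏᵢⱼ ∂ₖφ` of the second derivatives of `φ`, that is, the
component `II(∂ᵢ, ∂ⱼ)` of the vector-valued second fundamental form. -/
noncomputable def secondFundamental {n : ℕ}
    (φ : EuclideanSpace ℝ (Fin n) → EuclideanSpace ℝ (Fin (n + 1))) (i j : Fin n)
    (u : EuclideanSpace ℝ (Fin n)) : EuclideanSpace ℝ (Fin (n + 1)) :=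
  coordDeriv i (coordDeriv j φ) u - ∑ k, christoffel (inducedMetric φ) k i j u • coordDeriv k φ u

section Gauss

variable {n : ℕ} {U : Set (EuclideanSpace ℝ (Fin n))}
  {φ : EuclideanSpace ℝ (Fin n) → EuclideanSpace ℝ (Fin (n + 1))}

lemma inducedMetric_apply (φ : EuclideanSpace ℝ (Fin n) → EuclideanSpace ℝ (Fin (n + 1)))
    (u : EuclideanSpace ℝ (Fin n)) (i j : Fin n) :
    inducedMetric φ u i j = ⟪coordDeriv i φ u, coordDeriv j φ u⟫ := rfl

lemma inducedMetric_symm (φ : EuclideanSpace ℝ (Fin n) → EuclideanSpace ℝ (Fin (n + 1)))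
    (u : EuclideanSpace ℝ (Fin n)) (i j : Fin n) :
    inducedMetric φ u i j = inducedMetric φ u j i :=
  real_inner_comm (coordDeriv j φ u) (coordDeriv i φ u)

lemma det_inducedMetric_ne_zero {u : EuclideanSpace ℝ (Fin n)}
    (himm : Function.Injective (fderiv ℝ φ u)) : (inducedMetric φ u).det ≠ 0 := by
  refine (Matrix.det_gram_ne_zero_iff_linearIndependent (𝕜 := ℝ)
    (v := fun i => fderiv ℝ φ u (EuclideanSpace.single i 1))).mpr ?_
  have h := (EuclideanSpace.basisFun (Fin n) ℝ).toBasis.linearIndependent.map'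
    (fderiv ℝ φ u).toLinearMap (LinearMap.ker_eq_bot.mpr himm)
  have he : (fun i => fderiv ℝ φ u (EuclideanSpace.single i 1)) =
      (fderiv ℝ φ u).toLinearMap ∘ (EuclideanSpace.basisFun (Fin n) ℝ).toBasis := by
    ext i : 1
    simp
  rw [he]
  exact h

lemma partialDeriv_inducedMetric (hU : IsOpen U) (hφ : ContDiffOn ℝ ∞ φ U) (k i j : Fin n)
    {u : EuclideanSpace ℝ (Fin n)} (hu : u ∈ U) :
    partialDeriv k (fun y => inducedMetric φ y i j) u =
      ⟪coordDeriv i φ u, coordDeriv k (coordDeriv j φ) u⟫ +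
        ⟪coordDeriv k (coordDeriv i φ) u, coordDeriv j φ u⟫ :=
  coordDeriv_inner ((hφ.coordDeriv hU i).differentiableAt_of_isOpen hU hu)
    ((hφ.coordDeriv hU j).differentiableAt_of_isOpen hU hu) k

lemma christoffel_inducedMetric (hU : IsOpen U) (hφ : ContDiffOn ℝ ∞ φ U) (k i j : Fin n)
    {u : EuclideanSpace ℝ (Fin n)} (hu : u ∈ U) :
    christoffel (inducedMetric φ) k i j u =
      ∑ l, (inducedMetric φ u)⁻¹ k l * ⟪coordDeriv i (coordDeriv j φ) u, coordDeriv l φ u⟫ := by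
  rw [christoffel, Finset.mul_sum]
  refine Finset.sum_congr rfl fun l _ => ?_
  rw [partialDeriv_inducedMetric hU hφ _ _ _ hu, partialDeriv_inducedMetric hU hφ _ _ _ hu,
    partialDeriv_inducedMetric hU hφ _ _ _ hu, coordDeriv_comm hU hφ j i hu,
    coordDeriv_comm hU hφ l i hu, coordDeriv_comm hU hφ l j hu,
    real_inner_comm (coordDeriv i (coordDeriv l φ) u) (coordDeriv j φ u)]
  ring

lemma differentiableAt_christoffel (hU : IsOpen U) (hφ : ContDiffOn ℝ ∞ φ U)
    (himm : ∀ u ∈ U, Function.Injective (fderiv ℝ φ u)) (k i j : Fin n)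
    {u : EuclideanSpace ℝ (Fin n)} (hu : u ∈ U) :
    DifferentiableAt ℝ (christoffel (inducedMetric φ) k i j) u := by
  have hd : ∀ l, DifferentiableAt ℝ (coordDeriv l φ) u := fun l =>
    (hφ.coordDeriv hU l).differentiableAt_of_isOpen hU hu
  have hdd := ((hφ.coordDeriv hU j).coordDeriv hU i).differentiableAt_of_isOpen hU hu
  have hs : DifferentiableAt ℝ (fun u => ∑ l, (inducedMetric φ u)⁻¹ k l *
      ⟪coordDeriv i (coordDeriv j φ) u, coordDeriv l φ u⟫) u :=
    DifferentiableAt.fun_sum fun l _ =>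
      (DifferentiableAt.matrix_inv_apply (fun i j => (hd i).inner ℝ (hd j))
        (det_inducedMetric_ne_zero (himm u hu)) k l).mul (hdd.inner ℝ (hd l))
  refine hs.congr_of_eventuallyEq (Filter.mem_of_superset (hU.mem_nhds hu) fun y hy => ?_)
  exact christoffel_inducedMetric hU hφ k i j hy

/-- The Christoffel symbols of the induced metric give the tangential part of `∂ᵢ∂ⱼφ`. -/
lemma inner_coordDeriv_coordDeriv (hU : IsOpen U) (hφ : ContDiffOn ℝ ∞ φ U)
    (himm : ∀ u ∈ U, Function.Injective (fderiv ℝ φ u)) (i j m : Fin n)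
    {u : EuclideanSpace ℝ (Fin n)} (hu : u ∈ U) :
    ⟪coordDeriv i (coordDeriv j φ) u, coordDeriv m φ u⟫ =
      ∑ k, christoffel (inducedMetric φ) k i j u * inducedMetric φ u k m := by
  have hinv : (inducedMetric φ u) * (inducedMetric φ u)⁻¹ = 1 :=
    Matrix.mul_nonsing_inv _ (det_inducedMetric_ne_zero (himm u hu)).isUnit
  have key : ∀ l, ∑ k, inducedMetric φ u m k * (inducedMetric φ u)⁻¹ k l =
      if m = l then 1 else 0 := fun l => by
    rw [← Matrix.mul_apply, hinv, Matrix.one_apply]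
  have hsum : ∀ l, ∑ k, (inducedMetric φ u)⁻¹ k l *
      ⟪coordDeriv i (coordDeriv j φ) u, coordDeriv l φ u⟫ * inducedMetric φ u k m =
      (if m = l then 1 else 0) * ⟪coordDeriv i (coordDeriv j φ) u, coordDeriv l φ u⟫ := fun l => by
    rw [← key l, Finset.sum_mul]
    refine Finset.sum_congr rfl fun k _ => ?_
    rw [inducedMetric_symm φ u k m]
    ring
  simp_rw [christoffel_inducedMetric hU hφ _ _ _ hu, Finset.sum_mul]
  rw [Finset.sum_comm, Finset.sum_congr rfl fun l _ => hsum l]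
  simp

lemma inner_secondFundamental_coordDeriv (hU : IsOpen U) (hφ : ContDiffOn ℝ ∞ φ U)
    (himm : ∀ u ∈ U, Function.Injective (fderiv ℝ φ u)) (i j m : Fin n)
    {u : EuclideanSpace ℝ (Fin n)} (hu : u ∈ U) :
    ⟪secondFundamental φ i j u, coordDeriv m φ u⟫ = 0 := by
  simp only [secondFundamental, inner_sub_left, sum_inner, real_inner_smul_left,
    ← inducedMetric_apply, inner_coordDeriv_coordDeriv hU hφ himm i j m hu, sub_self]

/-- Pairing with a normal vector only sees the normal part of `∂ᵢ∂ⱼφ`. -/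
lemma inner_secondFundamental_secondFundamental (hU : IsOpen U) (hφ : ContDiffOn ℝ ∞ φ U)
    (himm : ∀ u ∈ U, Function.Injective (fderiv ℝ φ u)) (i j k l : Fin n)
    {u : EuclideanSpace ℝ (Fin n)} (hu : u ∈ U) :
    ⟪secondFundamental φ i j u, secondFundamental φ k l u⟫ =
      ⟪coordDeriv i (coordDeriv j φ) u, coordDeriv k (coordDeriv l φ) u⟫ -
        ∑ m, christoffel (inducedMetric φ) m i j u *
          ⟪coordDeriv m φ u, coordDeriv k (coordDeriv l φ) u⟫ := by
  conv_lhs => rw [secondFundamental.eq_1 φ k l u]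
  simp only [inner_sub_right, inner_sum, real_inner_smul_right,
    inner_secondFundamental_coordDeriv hU hφ himm _ _ _ hu, mul_zero, Finset.sum_const_zero,
    sub_zero]
  simp only [secondFundamental, inner_sub_left, sum_inner, real_inner_smul_left]

/-- The derivative of `⟨∂ⱼ∂ₖφ, ∂ₘφ⟩ = ∑ₗ Γˡⱼₖ gₗₘ` in the direction `i`. -/
lemma inner_thirdDeriv_coordDeriv (hU : IsOpen U) (hφ : ContDiffOn ℝ ∞ φ U)
    (himm : ∀ u ∈ U, Function.Injective (fderiv ℝ φ u)) (i j k m : Fin n)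
    {u : EuclideanSpace ℝ (Fin n)} (hu : u ∈ U) :
    ⟪coordDeriv i (coordDeriv j (coordDeriv k φ)) u, coordDeriv m φ u⟫ =
      ∑ l, partialDeriv i (christoffel (inducedMetric φ) l j k) u * inducedMetric φ u l m +
      ∑ l, christoffel (inducedMetric φ) l j k u *
        (∑ p, christoffel (inducedMetric φ) p i l u * inducedMetric φ u p m) -
      ⟪secondFundamental φ j k u, secondFundamental φ i m u⟫ := by
  have hd : ∀ l, DifferentiableAt ℝ (coordDeriv l φ) u := fun l =>
    (hφ.coordDeriv hU l).differentiableAt_of_isOpen hU hu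
  have hdd := ((hφ.coordDeriv hU k).coordDeriv hU j).differentiableAt_of_isOpen hU hu
  have h := coordDeriv_congr hU (fun y hy => inner_coordDeriv_coordDeriv hU hφ himm j k m hy) i hu
  rw [coordDeriv_inner hdd (hd m)] at h
  have hg : ∀ l, DifferentiableAt ℝ (fun y => inducedMetric φ y l m) u :=
    fun l => (hd l).inner ℝ (hd m)
  have hΓ : ∀ l, DifferentiableAt ℝ (christoffel (inducedMetric φ) l j k) u :=
    fun l => differentiableAt_christoffel hU hφ himm l j k hu
  have hr : coordDeriv i (fun y => ∑ l, christoffel (inducedMetric φ) l j k y *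
      inducedMetric φ y l m) u =
      ∑ l, (christoffel (inducedMetric φ) l j k u *
          partialDeriv i (fun y => inducedMetric φ y l m) u +
        partialDeriv i (christoffel (inducedMetric φ) l j k) u * inducedMetric φ u l m) := by
    rw [coordDeriv, (HasFDerivAt.fun_sum fun l _ =>
      (hΓ l).hasFDerivAt.fun_mul (hg l).hasFDerivAt).fderiv, sum_apply]
    refine Finset.sum_congr rfl fun l _ => ?_
    simp [partialDeriv, mul_comm]
  rw [hr] at h
  simp_rw [partialDeriv_inducedMetric hU hφ _ _ _ hu, inner_coordDeriv_coordDeriv hU hφ himm _ _ _ hu,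
    mul_add, Finset.sum_add_distrib] at h
  rw [inner_secondFundamental_secondFundamental hU hφ himm _ _ _ _ hu]
  linarith

/-- The **Gauss equation** for an immersion into Euclidean space, in components. -/
theorem gauss_equation (hU : IsOpen U) (hφ : ContDiffOn ℝ ∞ φ U)
    (himm : ∀ u ∈ U, Function.Injective (fderiv ℝ φ u)) (i j k m : Fin n)
    {u : EuclideanSpace ℝ (Fin n)} (hu : u ∈ U) :
    ∑ l, inducedMetric φ u l m * riemannTensor (inducedMetric φ) l i j k u =
      ⟪secondFundamental φ j k u, secondFundamental φ i m u⟫ -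
        ⟪secondFundamental φ i k u, secondFundamental φ j m u⟫ := by
  have h₁ := inner_thirdDeriv_coordDeriv hU hφ himm i j k m hu
  have h₂ := inner_thirdDeriv_coordDeriv hU hφ himm j i k m hu
  rw [coordDeriv_comm hU (hφ.coordDeriv hU k) j i hu] at h₂
  have hquad : ∀ i j : Fin n, ∑ l, christoffel (inducedMetric φ) l j k u *
        (∑ p, christoffel (inducedMetric φ) p i l u * inducedMetric φ u p m) =
      ∑ l, inducedMetric φ u l m * ∑ p, christoffel (inducedMetric φ) l i p u *
        christoffel (inducedMetric φ) p j k u := fun i j => by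
    simp_rw [Finset.mul_sum]
    rw [Finset.sum_comm]
    refine Finset.sum_congr rfl fun l _ => Finset.sum_congr rfl fun p _ => ?_
    ring
  rw [hquad] at h₁ h₂
  have hR : ∑ l, inducedMetric φ u l m * riemannTensor (inducedMetric φ) l i j k u =
      ∑ l, partialDeriv i (christoffel (inducedMetric φ) l j k) u * inducedMetric φ u l m -
      ∑ l, partialDeriv j (christoffel (inducedMetric φ) l i k) u * inducedMetric φ u l m +
      (∑ l, inducedMetric φ u l m * ∑ p, christoffel (inducedMetric φ) l i p u *
        christoffel (inducedMetric φ) p j k u -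
      ∑ l, inducedMetric φ u l m * ∑ p, christoffel (inducedMetric φ) l j p u *
        christoffel (inducedMetric φ) p i k u) := by
    simp_rw [← Finset.sum_sub_distrib, ← Finset.sum_add_distrib]
    refine Finset.sum_congr rfl fun l _ => ?_
    rw [riemannTensor, Finset.sum_sub_distrib]
    ring
  linarith

/-- The vector-valued second fundamental form `II(a, b)` of an immersion. -/
noncomputable def secondFundamentalForm
    (φ : EuclideanSpace ℝ (Fin n) → EuclideanSpace ℝ (Fin (n + 1)))
    (u a b : EuclideanSpace ℝ (Fin n)) : EuclideanSpace ℝ (Fin (n + 1)) :=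
  ∑ i, ∑ j, (a i * b j) • secondFundamental φ i j u

lemma metricValue_inducedMetric (φ : EuclideanSpace ℝ (Fin n) → EuclideanSpace ℝ (Fin (n + 1)))
    (u a b : EuclideanSpace ℝ (Fin n)) :
    metricValue (inducedMetric φ) u a b = ⟪fderiv ℝ φ u a, fderiv ℝ φ u b⟫ := by
  simp only [fderiv_apply_eq_sum_coordDeriv, sum_inner, real_inner_smul_left]
  simp only [inner_sum, real_inner_smul_right, Finset.mul_sum, metricValue, inducedMetric_apply]
  refine Finset.sum_congr rfl fun i _ => Finset.sum_congr rfl fun j _ => ?_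
  ring

lemma inner_secondFundamentalForm (φ : EuclideanSpace ℝ (Fin n) → EuclideanSpace ℝ (Fin (n + 1)))
    (u a b c d : EuclideanSpace ℝ (Fin n)) :
    ⟪secondFundamentalForm φ u a b, secondFundamentalForm φ u c d⟫ =
      ∑ i, ∑ j, ∑ k, ∑ l, a i * b j * (c k * d l) *
        ⟪secondFundamental φ i j u, secondFundamental φ k l u⟫ := by
  simp only [secondFundamentalForm, sum_inner, real_inner_smul_left]
  simp only [inner_sum, real_inner_smul_right, Finset.mul_sum]
  refine Finset.sum_congr rfl fun i _ => Finset.sum_congr rfl fun j _ =>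
    Finset.sum_congr rfl fun k _ => Finset.sum_congr rfl fun l _ => ?_
  ring

/-- The Gauss equation `⟨R(a, b)b, a⟩ = ⟨II(b, b), II(a, a)⟩ - ⟨II(a, b), II(b, a)⟩`. -/
theorem metricValue_curvatureVector (hU : IsOpen U) (hφ : ContDiffOn ℝ ∞ φ U)
    (himm : ∀ u ∈ U, Function.Injective (fderiv ℝ φ u))
    {u : EuclideanSpace ℝ (Fin n)} (hu : u ∈ U) (a b : EuclideanSpace ℝ (Fin n)) :
    metricValue (inducedMetric φ) u (curvatureVector (inducedMetric φ) u a b b) a =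
      ⟪secondFundamentalForm φ u b b, secondFundamentalForm φ u a a⟫ -
        ⟪secondFundamentalForm φ u a b, secondFundamentalForm φ u b a⟫ := by
  have h : metricValue (inducedMetric φ) u (curvatureVector (inducedMetric φ) u a b b) a =
      ∑ i, ∑ j, ∑ k, ∑ m, a i * b j * (b k * a m) *
        ∑ l, inducedMetric φ u l m * riemannTensor (inducedMetric φ) l i j k u := by
    simp only [metricValue, curvatureVector, Finset.mul_sum, Finset.sum_mul]
    -- reorder the sums so that the contracted index `l` is innermost, next to `m`
    calc _ = ∑ l, ∑ i, ∑ j, ∑ k, ∑ m, inducedMetric φ u l m *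
          (riemannTensor (inducedMetric φ) l i j k u * a i * b j * b k) * a m := by
          refine Finset.sum_congr rfl fun l _ => ?_
          rw [Finset.sum_comm]
          refine Finset.sum_congr rfl fun i _ => ?_
          rw [Finset.sum_comm]
          refine Finset.sum_congr rfl fun j _ => ?_
          rw [Finset.sum_comm]
      _ = _ := by
          rw [Finset.sum_comm]
          refine Finset.sum_congr rfl fun i _ => ?_
          rw [Finset.sum_comm]
          refine Finset.sum_congr rfl fun j _ => ?_
          rw [Finset.sum_comm]
          refine Finset.sum_congr rfl fun k _ => ?_
          rw [Finset.sum_comm]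
          refine Finset.sum_congr rfl fun m _ => Finset.sum_congr rfl fun l _ => ?_
          ring
  rw [h, inner_secondFundamentalForm, inner_secondFundamentalForm]
  simp_rw [gauss_equation hU hφ himm _ _ _ _ hu, mul_sub, Finset.sum_sub_distrib]
  refine congrArg₂ (· - ·) ?_ ?_
  · calc _ = ∑ j, ∑ k, ∑ i, ∑ m, a i * b j * (b k * a m) *
          ⟪secondFundamental φ j k u, secondFundamental φ i m u⟫ := by
          rw [Finset.sum_comm]
          refine Finset.sum_congr rfl fun j _ => ?_
          rw [Finset.sum_comm]
      _ = _ := by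
          refine Finset.sum_congr rfl fun j _ => Finset.sum_congr rfl fun k _ =>
            Finset.sum_congr rfl fun i _ => Finset.sum_congr rfl fun m _ => ?_
          ring
  · refine Finset.sum_congr rfl fun i _ => ?_
    rw [Finset.sum_comm]
    refine Finset.sum_congr rfl fun k _ => Finset.sum_congr rfl fun j _ =>
      Finset.sum_congr rfl fun m _ => ?_
    ring

end Gauss

/-! ### The second fundamental form of a regular level set -/

section LevelSet

variable {n : ℕ} {f : EuclideanSpace ℝ (Fin (n + 1)) → ℝ}
  {U : Set (EuclideanSpace ℝ (Fin n))}
  {φ : EuclideanSpace ℝ (Fin n) → EuclideanSpace ℝ (Fin (n + 1))}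

lemma mem_levelTangent_iff {x v : EuclideanSpace ℝ (Fin (n + 1))} :
    v ∈ levelTangent f x ↔ fderiv ℝ f x v = 0 := by
  rw [levelTangent, Submodule.mem_orthogonal_singleton_iff_inner_right, inner_gradient_left]

lemma finrank_levelTangent {x : EuclideanSpace ℝ (Fin (n + 1))} (hx : gradient f x ≠ 0) :
    Module.finrank ℝ (levelTangent f x) = n := by
  have : Fact (Module.finrank ℝ (EuclideanSpace ℝ (Fin (n + 1))) = n + 1) := ⟨by simp⟩
  exact Submodule.finrank_orthogonal_span_singleton hx

lemma hess_comm (hf : ContDiff ℝ ∞ f) (x v w : EuclideanSpace ℝ (Fin (n + 1))) :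
    hess f x v w = hess f x w v :=
  hf.contDiffAt.isSymmSndFDerivAt (by
    rw [minSmoothness_of_isRCLikeNormedField]
    exact WithTop.coe_le_coe.2 (le_top (a := (2 : ℕ∞)))) v w

lemma differentiable_fderiv (hf : ContDiff ℝ ∞ f) : Differentiable ℝ (fderiv ℝ f) :=
  (hf.fderiv_right (m := ∞) (by simp)).differentiable (by simp)

lemma IsLocalParametrization.apply_eq_zero (h : IsLocalParametrization (zeroLevel f) U φ)
    {u : EuclideanSpace ℝ (Fin n)} (hu : u ∈ U) : f (φ u) = 0 := by
  obtain ⟨V, -, hV⟩ := h.image_eq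
  exact (hV.subset (Set.mem_image_of_mem φ hu)).1

lemma IsLocalParametrization.fderiv_comp_eq_zero (h : IsLocalParametrization (zeroLevel f) U φ)
    (hf : ContDiff ℝ ∞ f) {u : EuclideanSpace ℝ (Fin n)} (hu : u ∈ U)
    (a : EuclideanSpace ℝ (Fin n)) : fderiv ℝ f (φ u) (fderiv ℝ φ u a) = 0 := by
  have hφ := h.smooth.differentiableAt_of_isOpen h.isOpen hu
  have he : f ∘ φ =ᶠ[nhds u] fun _ => (0 : ℝ) :=
    Filter.mem_of_superset (h.isOpen.mem_nhds hu) fun y hy => h.apply_eq_zero hy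
  have hc := he.fderiv_eq (𝕜 := ℝ)
  rw [fderiv_comp u (hf.differentiable (by simp) _) hφ, fderiv_fun_const] at hc
  simpa using congrArg (fun A => A a) hc

lemma IsLocalParametrization.range_fderiv (h : IsLocalParametrization (zeroLevel f) U φ)
    (hf : ContDiff ℝ ∞ f) {u : EuclideanSpace ℝ (Fin n)} (hu : u ∈ U)
    (hx : gradient f (φ u) ≠ 0) :
    (fderiv ℝ φ u).toLinearMap.range = levelTangent f (φ u) := by
  refine Submodule.eq_of_le_of_finrank_eq ?_ ?_
  · rintro _ ⟨a, rfl⟩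
    exact mem_levelTangent_iff.mpr (h.fderiv_comp_eq_zero hf hu a)
  · rw [finrank_levelTangent hx, LinearMap.finrank_range_of_inj (h.immersion u hu)]
    simp

/-- Differentiating `df(∂ⱼφ) = 0` along `∂ᵢφ`. -/
lemma IsLocalParametrization.inner_gradient_secondFundamental
    (h : IsLocalParametrization (zeroLevel f) U φ) (hf : ContDiff ℝ ∞ f)
    {u : EuclideanSpace ℝ (Fin n)} (hu : u ∈ U) (i j : Fin n) :
    ⟪gradient f (φ u), secondFundamental φ i j u⟫ =
      -hess f (φ u) (coordDeriv i φ u) (coordDeriv j φ u) := by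
  have hφ := h.smooth.differentiableAt_of_isOpen h.isOpen hu
  have hφj := (h.smooth.coordDeriv h.isOpen j).differentiableAt_of_isOpen h.isOpen hu
  have hdf := differentiable_fderiv hf
  have h0 : coordDeriv i (fun y => fderiv ℝ f (φ y) (coordDeriv j φ y)) u = 0 := by
    rw [coordDeriv_congr h.isOpen (h := fun y => fderiv ℝ f (φ y) (coordDeriv j φ y))
      (h' := fun _ => 0) (fun y hy => h.fderiv_comp_eq_zero hf hy _) i hu]
    simp [coordDeriv]
  rw [coordDeriv, fderiv_clm_apply (c := fun y => fderiv ℝ f (φ y))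
    ((hdf _).comp u hφ) hφj, fderiv_fun_comp u (hdf _) hφ] at h0
  have htan : ∀ k, fderiv ℝ f (φ u) (coordDeriv k φ u) = 0 := fun k =>
    h.fderiv_comp_eq_zero hf hu _
  have h1 : fderiv ℝ f (φ u) (coordDeriv i (coordDeriv j φ) u) +
      hess f (φ u) (coordDeriv i φ u) (coordDeriv j φ u) = 0 := by
    simpa [coordDeriv, hess] using h0
  rw [inner_gradient_left, secondFundamental, map_sub, map_sum]
  simp only [map_smul, htan, smul_zero, Finset.sum_const_zero, sub_zero]
  linarith

lemma IsLocalParametrization.inner_gradient_secondFundamentalForm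
    (h : IsLocalParametrization (zeroLevel f) U φ) (hf : ContDiff ℝ ∞ f)
    {u : EuclideanSpace ℝ (Fin n)} (hu : u ∈ U) (a b : EuclideanSpace ℝ (Fin n)) :
    ⟪gradient f (φ u), secondFundamentalForm φ u a b⟫ =
      -hess f (φ u) (fderiv ℝ φ u a) (fderiv ℝ φ u b) := by
  simp only [secondFundamentalForm, inner_sum, real_inner_smul_right,
    h.inner_gradient_secondFundamental hf hu]
  simp only [hess, fderiv_apply_eq_sum_coordDeriv φ, map_sum, map_smul, sum_apply, smul_apply,
    smul_eq_mul, Finset.mul_sum, ← Finset.sum_neg_distrib]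
  rw [Finset.sum_comm]
  refine Finset.sum_congr rfl fun i _ => Finset.sum_congr rfl fun j _ => ?_
  ring

/-- The second fundamental form of a regular level set is `-Hess(f) ∇f / ‖∇f‖²`. -/
lemma IsLocalParametrization.secondFundamentalForm_eq
    (h : IsLocalParametrization (zeroLevel f) U φ) (hf : ContDiff ℝ ∞ f)
    {u : EuclideanSpace ℝ (Fin n)} (hu : u ∈ U) (hx : gradient f (φ u) ≠ 0)
    (a b : EuclideanSpace ℝ (Fin n)) :
    secondFundamentalForm φ u a b =
      (-hess f (φ u) (fderiv ℝ φ u a) (fderiv ℝ φ u b) / ‖gradient f (φ u)‖ ^ 2) •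
        gradient f (φ u) := by
  have hmem : secondFundamentalForm φ u a b ∈ Submodule.span ℝ {gradient f (φ u)} := by
    rw [← Submodule.orthogonal_orthogonal (Submodule.span ℝ {gradient f (φ u)}),
      Submodule.mem_orthogonal']
    intro w hw
    obtain ⟨c, rfl⟩ := (h.range_fderiv hf hu hx).ge hw
    change ⟪_, fderiv ℝ φ u c⟫ = 0
    simp only [secondFundamentalForm, fderiv_apply_eq_sum_coordDeriv, sum_inner, inner_sum,
      real_inner_smul_left, real_inner_smul_right,
      inner_secondFundamental_coordDeriv h.isOpen h.smooth h.immersion _ _ _ hu, mul_zero,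
      Finset.sum_const_zero]
  obtain ⟨c, hc⟩ := Submodule.mem_span_singleton.mp hmem
  have hi := h.inner_gradient_secondFundamentalForm hf hu a b
  rw [← hc, real_inner_smul_right, real_inner_self_eq_norm_sq] at hi
  rw [← hc, ← hi, mul_div_cancel_right₀]
  simpa using hx

/-- The curvature of a regular level set in terms of the Hessian, for any two tangent vectors. -/
theorem HasSectionalCurvature.eq_hess (hf : ContDiff ℝ ∞ f)
    {x v w : EuclideanSpace ℝ (Fin (n + 1))} (hx : gradient f x ≠ 0) {K : ℝ}
    (hK : HasSectionalCurvature (zeroLevel f) x v w K) :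
    K = (hess f x v v * hess f x w w - hess f x v w ^ 2) / ‖gradient f x‖ ^ 2 /
      (‖v‖ ^ 2 * ‖w‖ ^ 2 - ⟪v, w⟫ ^ 2) := by
  obtain ⟨U, φ, p, a, b, h, hp, rfl, rfl, rfl, rfl⟩ := hK
  have hg : ‖gradient f (φ p)‖ ≠ 0 := by simpa using hx
  rw [metricSectionalCurvature, metricValue_curvatureVector h.isOpen h.smooth h.immersion hp]
  simp only [h.secondFundamentalForm_eq hf hp hx, metricValue_inducedMetric,
    real_inner_smul_left, real_inner_smul_right, real_inner_self_eq_norm_sq]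
  congr 1
  rw [hess_comm hf _ (fderiv ℝ φ p b) (fderiv ℝ φ p a)]
  field_simp

/-! ### Local parametrizations of a regular level set -/

/-- Near a regular point, a level set is parametrized by orthogonal projection to the tangent
space: this is the inverse function theorem for `y ↦ (f(y), pr(y))`. -/
theorem exists_isLocalParametrization (hf : ContDiff ℝ ∞ f)
    {x : EuclideanSpace ℝ (Fin (n + 1))} (hx : x ∈ zeroLevel f) (hg : gradient f x ≠ 0) :
    ∃ (U : Set (EuclideanSpace ℝ (Fin n)))
      (φ : EuclideanSpace ℝ (Fin n) → EuclideanSpace ℝ (Fin (n + 1)))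
      (p : EuclideanSpace ℝ (Fin n)),
      IsLocalParametrization (zeroLevel f) U φ ∧ p ∈ U ∧ φ p = x := by
  let e : levelTangent f x ≃L[ℝ] EuclideanSpace ℝ (Fin n) :=
    ContinuousLinearEquiv.ofFinrankEq (by rw [finrank_levelTangent hg]; simp)
  let L : EuclideanSpace ℝ (Fin (n + 1)) →L[ℝ] EuclideanSpace ℝ (Fin n) :=
    e.toContinuousLinearMap ∘L (levelTangent f x).orthogonalProjectionOnto
  let F : EuclideanSpace ℝ (Fin (n + 1)) → ℝ × EuclideanSpace ℝ (Fin n) := fun y => (f y, L y)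
  have hF : ContDiff ℝ ∞ F := hf.prodMk L.contDiff
  have hF' : ∀ y, HasFDerivAt F ((fderiv ℝ f y).prod L) y := fun y =>
    (hf.differentiable (by simp) y).hasFDerivAt.prodMk L.hasFDerivAt
  have hinj : Function.Injective ((fderiv ℝ f x).prod L).toLinearMap := by
    rw [← LinearMap.ker_eq_bot, LinearMap.ker_eq_bot']
    intro v hv
    have hv1 : fderiv ℝ f x v = 0 := congrArg Prod.fst hv
    have hv2 : L v = 0 := congrArg Prod.snd hv
    have hv3 : (levelTangent f x).orthogonalProjectionOnto v = 0 := by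
      simpa [L] using hv2
    have hmem := mem_levelTangent_iff.mpr hv1
    have := Submodule.orthogonalProjectionOnto_mem_subspace_eq_self
      (⟨v, hmem⟩ : levelTangent f x)
    rw [show (levelTangent f x).orthogonalProjectionOnto v = ⟨v, hmem⟩ from this] at hv3
    exact congrArg Subtype.val hv3
  let A : EuclideanSpace ℝ (Fin (n + 1)) ≃L[ℝ] ℝ × EuclideanSpace ℝ (Fin n) :=
    (LinearMap.linearEquivOfInjective _ hinj (by simp [add_comm])).toContinuousLinearEquiv
  have hA : (A : EuclideanSpace ℝ (Fin (n + 1)) →L[ℝ] ℝ × EuclideanSpace ℝ (Fin n)) =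
      (fderiv ℝ f x).prod L := by
    ext1 v
    rfl
  -- smoothness of the local inverse is needed at all points, so the source of the local
  -- homeomorphism is restricted to where `dF` is invertible
  let W : Set (EuclideanSpace ℝ (Fin (n + 1))) := {y | (fderiv ℝ f y).prod L ∈
    Set.range (ContinuousLinearEquiv.toContinuousLinearMap :
      (EuclideanSpace ℝ (Fin (n + 1)) ≃L[ℝ] ℝ × EuclideanSpace ℝ (Fin n)) → _)}
  have hW : IsOpen W := by
    refine ContinuousLinearEquiv.isOpen.preimage (f := fun y => (fderiv ℝ f y).prod L) ?_
    have hc : Continuous (fderiv ℝ F) := hF.continuous_fderiv (by simp)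
    rwa [show fderiv ℝ F = fun y => (fderiv ℝ f y).prod L from funext fun y => (hF' y).fderiv]
      at hc
  have hAx : HasFDerivAt F
      (A : EuclideanSpace ℝ (Fin (n + 1)) →L[ℝ] ℝ × EuclideanSpace ℝ (Fin n)) x :=
    hA ▸ hF' x
  let P₀ := hF.contDiffAt.toOpenPartialHomeomorph F hAx (by simp)
  let P := P₀.restrOpen W hW
  have hPF : ∀ y, P y = F y := fun y => rfl
  have hPW : P.source ⊆ W := Set.inter_subset_right
  have hxP : x ∈ P.source :=
    ⟨hF.contDiffAt.mem_toOpenPartialHomeomorph_source hAx (by simp), A, hA⟩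
  have hsymm : ∀ q ∈ P.target, F (P.symm q) = q := fun q hq => P.right_inv hq
  let j : EuclideanSpace ℝ (Fin n) → ℝ × EuclideanSpace ℝ (Fin n) := fun u => (0, u)
  have hj : ContDiff ℝ ∞ j := contDiff_const.prodMk contDiff_id
  let U : Set (EuclideanSpace ℝ (Fin n)) := j ⁻¹' P.target
  have hU : IsOpen U := P.open_target.preimage hj.continuous
  have hLφ : ∀ u ∈ U, L (P.symm (j u)) = u := fun u hu => congrArg Prod.snd (hsymm _ hu)
  have hfφ : ∀ u ∈ U, f (P.symm (j u)) = 0 := fun u hu => congrArg Prod.fst (hsymm _ hu)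
  have hsmooth : ContDiffOn ℝ ∞ (fun u => P.symm (j u)) U := by
    intro u hu
    obtain ⟨B, hB⟩ := hPW (P.map_target hu)
    have hB' : HasFDerivAt P
        (B : EuclideanSpace ℝ (Fin (n + 1)) →L[ℝ] ℝ × EuclideanSpace ℝ (Fin n))
        (P.symm (j u)) := hB ▸ hF' _
    exact ((P.contDiffAt_symm hu hB' hF.contDiffAt).comp u hj.contDiffAt).contDiffWithinAt
  have hjx : ∀ y ∈ P.source, f y = 0 → j (L y) = P y := fun y _ hy => by
    rw [hPF]
    exact Prod.ext hy.symm rfl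
  refine ⟨U, fun u => P.symm (j u), L x, ⟨hU, hsmooth, ?_, ?_, P.source, P.open_source, ?_⟩, ?_, ?_⟩
  -- `L` is a left inverse of the parametrization, so its derivative is injective
  · intro u hu
    have hd : HasFDerivAt (fun u => L (P.symm (j u)))
        (L ∘L fderiv ℝ (fun u => P.symm (j u)) u) u :=
      L.hasFDerivAt.comp u (hsmooth.differentiableAt_of_isOpen hU hu).hasFDerivAt
    have hid : HasFDerivAt (fun u => L (P.symm (j u)))
        (ContinuousLinearMap.id ℝ (EuclideanSpace ℝ (Fin n))) u :=
      (hasFDerivAt_id u).congr_of_eventuallyEq (Filter.mem_of_superset (hU.mem_nhds hu) hLφ)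
    have hcomp := hd.unique hid
    exact Function.LeftInverse.injective (g := L) fun a => congrArg (fun T => T a) hcomp
  · refine Topology.IsEmbedding.of_comp hsmooth.continuousOn.domRestrict L.continuous ?_
    convert Topology.IsEmbedding.subtypeVal (p := (· ∈ U)) using 1
    funext u
    exact hLφ u u.2
  · ext y
    constructor
    · rintro ⟨u, hu, rfl⟩
      exact ⟨hfφ u hu, P.map_target hu⟩
    · rintro ⟨hy, hyP⟩
      have := hjx y hyP hy
      exact ⟨L y, by change j (L y) ∈ P.target; rw [this]; exact P.map_source hyP,
        by change P.symm (j (L y)) = y; rw [this]; exact P.left_inv hyP⟩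
  · change j (L x) ∈ P.target
    rw [hjx x hxP hx]
    exact P.map_source hxP
  · change P.symm (j (L x)) = x
    rw [hjx x hxP hx]
    exact P.left_inv hxP

theorem exists_hasSectionalCurvature (hf : ContDiff ℝ ∞ f)
    {x v w : EuclideanSpace ℝ (Fin (n + 1))} (hx : x ∈ zeroLevel f) (hg : gradient f x ≠ 0)
    (hv : v ∈ levelTangent f x) (hw : w ∈ levelTangent f x) :
    ∃ K, HasSectionalCurvature (zeroLevel f) x v w K := by
  obtain ⟨U, φ, p, h, hp, rfl⟩ := exists_isLocalParametrization hf hx hg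
  obtain ⟨a, rfl⟩ := (h.range_fderiv hf hp hg).ge hv
  obtain ⟨b, rfl⟩ := (h.range_fderiv hf hp hg).ge hw
  exact ⟨_, U, φ, p, a, b, h, hp, rfl, rfl, rfl, rfl⟩

theorem sectionalCurvature_zeroLevel (hf : ContDiff ℝ ∞ f)
    {x v w : EuclideanSpace ℝ (Fin (n + 1))} (hx : x ∈ zeroLevel f) (hg : gradient f x ≠ 0)
    (hv : v ∈ levelTangent f x) (hw : w ∈ levelTangent f x) :
    sectionalCurvature (zeroLevel f) x v w =
      (hess f x v v * hess f x w w - hess f x v w ^ 2) / ‖gradient f x‖ ^ 2 /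
        (‖v‖ ^ 2 * ‖w‖ ^ 2 - ⟪v, w⟫ ^ 2) := by
  have h := exists_hasSectionalCurvature hf hx hg hv hw
  rw [sectionalCurvature, dif_pos h]
  exact h.choose_spec.eq_hess hf hg

end LevelSet

/-! ### Definite forms and the sign of the curvature -/

lemma gram_det_pos_of_linearIndependent {E : Type*} [NormedAddCommGroup E]
    [InnerProductSpace ℝ E] {v w : E} (h : LinearIndependent ℝ ![v, w]) :
    0 < ‖v‖ ^ 2 * ‖w‖ ^ 2 - ⟪v, w⟫ ^ 2 := by
  have hd := (Matrix.posDef_gram_of_linearIndependent h).det_pos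
  rw [Matrix.det_fin_two] at hd
  simp only [Matrix.gram_apply, Matrix.cons_val_zero, Matrix.cons_val_one,
    real_inner_self_eq_norm_sq, real_inner_comm v w] at hd
  linarith

/-- A symmetric bilinear form on a space of dimension at least two has positive Gram determinants
on all planes exactly when it is definite. -/
theorem forall_linearIndependent_mul_sub_sq_pos_iff {E : Type*} [NormedAddCommGroup E]
    [NormedSpace ℝ E] (B : E →L[ℝ] E →L[ℝ] ℝ) (hB : ∀ v w, B v w = B w v) (T : Submodule ℝ E)
    (hT : 1 < Module.finrank ℝ T) :
    (∀ v ∈ T, ∀ w ∈ T, LinearIndependent ℝ ![v, w] → 0 < B v v * B w w - B v w ^ 2) ↔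
      (∀ v ∈ T, v ≠ 0 → 0 < B v v) ∨ (∀ v ∈ T, v ≠ 0 → B v v < 0) := by
  constructor
  · intro h
    have hne : ∀ v ∈ T, v ≠ 0 → B v v ≠ 0 := by
      intro v hv hv0 hBv
      obtain ⟨w, hw⟩ := exists_linearIndependent_pair_of_one_lt_finrank hT
        (x := ⟨v, hv⟩) (by simpa using hv0)
      have hw' : LinearIndependent ℝ ![v, (w : E)] := by
        rw [LinearIndependent.pair_iff] at hw ⊢
        exact fun s t hst => hw s t (Subtype.ext hst)
      have := h v hv w w.2 hw'
      rw [hBv] at this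
      nlinarith [sq_nonneg (B v w)]
    have hsign : ∀ v ∈ T, v ≠ 0 → ∀ w ∈ T, w ≠ 0 → 0 < B v v * B w w := by
      intro v hv hv0 w hw hw0
      by_cases hli : LinearIndependent ℝ ![v, w]
      · nlinarith [h v hv w hw hli, sq_nonneg (B v w)]
      · rw [LinearIndependent.pair_iff' hv0] at hli
        push Not at hli
        obtain ⟨c, rfl⟩ := hli
        have hc : c ≠ 0 := fun hc => hw0 (by simp [hc])
        have : B v v * B (c • v) (c • v) = (c * B v v) ^ 2 := by
          simp
          ring
        rw [this]
        have := mul_ne_zero hc (hne v hv hv0)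
        positivity
    by_contra! hcon
    obtain ⟨⟨v, hv, hv0, hBv⟩, w, hw, hw0, hBw⟩ := hcon
    nlinarith [hsign v hv hv0 w hw hw0]
  · intro h v hv w hw hli
    -- `z` spans the `B`-orthogonal complement of `v` in the plane of `v` and `w`
    set z := B v v • w - B v w • v with hz
    have hzT : z ∈ T := T.sub_mem (T.smul_mem _ hw) (T.smul_mem _ hv)
    have hBz : B z z = B v v * (B v v * B w w - B v w ^ 2) := by
      simp only [hz, map_sub, map_smul, sub_apply, smul_apply, smul_eq_mul, hB w v]
      ring
    have hv0 : v ≠ 0 := hli.ne_zero 0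
    have hz0 : B v v ≠ 0 → z ≠ 0 := fun hBv hz0 => by
      have := LinearIndependent.pair_iff.mp hli (-B v w) (B v v) (by rw [← hz0, hz]; module)
      exact hBv this.2
    rcases h with h | h
    · have h1 := h v hv hv0
      have h2 := h z hzT (hz0 h1.ne')
      rw [hBz] at h2
      exact pos_of_mul_pos_right h2 h1.le
    · have h1 := h v hv hv0
      have h2 := h z hzT (hz0 h1.ne)
      rw [hBz] at h2
      exact pos_of_mul_neg_right h2 h1.le

theorem posSectionalCurvatureAt_iff {n : ℕ} (hn : 2 ≤ n)
    {f : EuclideanSpace ℝ (Fin (n + 1)) → ℝ} (hf : ContDiff ℝ ∞ f)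
    {x : EuclideanSpace ℝ (Fin (n + 1))} (hx : x ∈ zeroLevel f) (hg : gradient f x ≠ 0) :
    PosSectionalCurvatureAt f x ↔ (HessPosDefAt f x ∨ HessNegDefAt f x) := by
  have hT : 1 < Module.finrank ℝ (levelTangent f x) := by
    rw [finrank_levelTangent hg]
    omega
  refine Iff.trans ?_ (forall_linearIndependent_mul_sub_sq_pos_iff
    (fderiv ℝ (fderiv ℝ f) x) (hess_comm hf x) (levelTangent f x) hT)
  have hg' : 0 < ‖gradient f x‖ ^ 2 := by
    have := norm_pos_iff.mpr hg
    positivity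
  refine forall₄_congr fun v hv w hw => forall_congr' fun hli => ?_
  rw [sectionalCurvature_zeroLevel hf hx hg hv hw,
    div_pos_iff_of_pos_right (gram_det_pos_of_linearIndependent hli),
    div_pos_iff_of_pos_right hg']
  rfl

/-! ### Constancy of the sign on a connected hypersurface -/

section Connected

variable {n : ℕ} {f : EuclideanSpace ℝ (Fin (n + 1)) → ℝ}

/-- The orthogonal projection of the `i`-th standard basis vector to the complement of `∇f(x)`. -/
noncomputable def tangentBasisVector (f : EuclideanSpace ℝ (Fin (n + 1)) → ℝ)
    (x : EuclideanSpace ℝ (Fin (n + 1))) (i : Fin (n + 1)) : EuclideanSpace ℝ (Fin (n + 1)) :=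
  EuclideanSpace.single i 1 -
    (⟪gradient f x, EuclideanSpace.single i 1⟫ / ‖gradient f x‖ ^ 2) • gradient f x

/-- The trace of the restriction of `Hess(f)_x` to `T_x M`. -/
noncomputable def tangentTrace (f : EuclideanSpace ℝ (Fin (n + 1)) → ℝ)
    (x : EuclideanSpace ℝ (Fin (n + 1))) : ℝ :=
  ∑ i, hess f x (tangentBasisVector f x i) (tangentBasisVector f x i)

lemma tangentBasisVector_mem {x : EuclideanSpace ℝ (Fin (n + 1))} (hg : gradient f x ≠ 0)
    (i : Fin (n + 1)) : tangentBasisVector f x i ∈ levelTangent f x := by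
  have hg' : ‖gradient f x‖ ≠ 0 := by simpa using hg
  rw [levelTangent, Submodule.mem_orthogonal_singleton_iff_inner_right, tangentBasisVector,
    inner_sub_right, real_inner_smul_right, real_inner_self_eq_norm_sq]
  field_simp
  simp

lemma exists_tangentBasisVector_ne_zero (hn : 0 < n) {x : EuclideanSpace ℝ (Fin (n + 1))}
    (hg : gradient f x ≠ 0) : ∃ i, tangentBasisVector f x i ≠ 0 := by
  by_contra! hcon
  have : Nontrivial (levelTangent f x) :=
    Module.nontrivial_of_finrank_pos (R := ℝ) (by rwa [finrank_levelTangent hg])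
  obtain ⟨v, hv⟩ := exists_ne (0 : levelTangent f x)
  have horth : ⟪(v : EuclideanSpace ℝ (Fin (n + 1))), gradient f x⟫ = 0 :=
    Submodule.mem_orthogonal_singleton_iff_inner_left.mp v.2
  refine hv (Subtype.ext ?_)
  ext i
  have h := congrArg (fun y => ⟪(v : EuclideanSpace ℝ (Fin (n + 1))), y⟫) (hcon i)
  simpa [tangentBasisVector, inner_sub_right, real_inner_smul_right, horth,
    EuclideanSpace.inner_single_right] using h

lemma continuousOn_tangentTrace (hf : ContDiff ℝ ∞ f) (hreg : ∀ x ∈ zeroLevel f, gradient f x ≠ 0) :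
    ContinuousOn (tangentTrace f) (zeroLevel f) := by
  have hgrad : Continuous (gradient f) :=
    (InnerProductSpace.toDual ℝ _).symm.continuous.comp (hf.continuous_fderiv (by simp))
  have hhess : Continuous (fderiv ℝ (fderiv ℝ f)) :=
    (hf.fderiv_right (m := ∞) (by simp)).continuous_fderiv (by simp)
  have hvec : ∀ i, ContinuousOn (fun x => tangentBasisVector f x i) (zeroLevel f) := fun i =>
    continuousOn_const.sub ((((hgrad.inner continuous_const).continuousOn).div
      ((hgrad.norm.pow 2).continuousOn) fun x hx => by simpa using hreg x hx).smul
        hgrad.continuousOn)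
  exact continuousOn_finsetSum _ fun i _ => (hhess.continuousOn.clm_apply (hvec i)).clm_apply (hvec i)

lemma HessPosDefAt.tangentTrace_pos (hn : 0 < n) {x : EuclideanSpace ℝ (Fin (n + 1))}
    (hg : gradient f x ≠ 0) (h : HessPosDefAt f x) : 0 < tangentTrace f x := by
  obtain ⟨i, hi⟩ := exists_tangentBasisVector_ne_zero hn hg
  refine Finset.sum_pos' (fun j _ => ?_) ⟨i, Finset.mem_univ i, h _ (tangentBasisVector_mem hg i) hi⟩
  by_cases hj : tangentBasisVector f x j = 0
  · simp [hj, hess]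
  · exact (h _ (tangentBasisVector_mem hg j) hj).le

lemma HessNegDefAt.tangentTrace_neg (hn : 0 < n) {x : EuclideanSpace ℝ (Fin (n + 1))}
    (hg : gradient f x ≠ 0) (h : HessNegDefAt f x) : tangentTrace f x < 0 := by
  obtain ⟨i, hi⟩ := exists_tangentBasisVector_ne_zero hn hg
  refine Finset.sum_neg' (fun j _ => ?_) ⟨i, Finset.mem_univ i, h _ (tangentBasisVector_mem hg i) hi⟩
  by_cases hj : tangentBasisVector f x j = 0
  · simp [hj, hess]
  · exact (h _ (tangentBasisVector_mem hg j) hj).le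

/-- On a connected hypersurface the trace of the restricted Hessian is continuous and, where the
Hessian is definite, does not vanish; hence its sign is constant. -/
theorem forall_hessPosDefAt_or_forall_hessNegDefAt (hn : 0 < n) (hf : ContDiff ℝ ∞ f)
    (hreg : ∀ x ∈ zeroLevel f, gradient f x ≠ 0) (hconn : IsPreconnected (zeroLevel f))
    (h : ∀ x ∈ zeroLevel f, HessPosDefAt f x ∨ HessNegDefAt f x) :
    (∀ x ∈ zeroLevel f, HessPosDefAt f x) ∨ (∀ x ∈ zeroLevel f, HessNegDefAt f x) := by
  by_contra! hcon
  obtain ⟨⟨x, hx, hxp⟩, y, hy, hyn⟩ := hcon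
  have hxneg := ((h x hx).resolve_left hxp).tangentTrace_neg hn (hreg x hx)
  have hypos := ((h y hy).resolve_right hyn).tangentTrace_pos hn (hreg y hy)
  obtain ⟨z, hz, hz0⟩ := hconn.intermediate_value hx hy (continuousOn_tangentTrace hf hreg)
    ⟨hxneg.le, hypos.le⟩
  rcases h z hz with hp | hp
  · exact (hp.tangentTrace_pos hn (hreg z hz)).ne' hz0
  · exact (hp.tangentTrace_neg hn (hreg z hz)).ne hz0

end Connected

/-! ### Curvature of regular level sets -/

theorem mainTheorem3 (n : ℕ) (hn : 2 ≤ n) (f : EuclideanSpace ℝ (Fin (n + 1)) → ℝ)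
    (hf : ContDiff ℝ ∞ f) (hreg : ∀ x ∈ zeroLevel f, gradient f x ≠ 0) :
    -- the sectional curvature exists and does not depend on the local parametrization
    (∀ x ∈ zeroLevel f, ∀ v ∈ levelTangent f x, ∀ w ∈ levelTangent f x,
      LinearIndependent ℝ ![v, w] → ∃! K, HasSectionalCurvature (zeroLevel f) x v w K) ∧
    -- the formula for orthonormal tangent vectors
    (∀ x ∈ zeroLevel f, ∀ v ∈ levelTangent f x, ∀ w ∈ levelTangent f x,
      ‖v‖ = 1 → ‖w‖ = 1 → ⟪v, w⟫ = 0 →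
        sectionalCurvature (zeroLevel f) x v w =
          (hess f x v v * hess f x w w - hess f x v w ^ 2) / ‖gradient f x‖ ^ 2) ∧
    -- positive curvature at a point
    (∀ x ∈ zeroLevel f,
      (PosSectionalCurvatureAt f x ↔ (HessPosDefAt f x ∨ HessNegDefAt f x))) ∧
    -- positive curvature everywhere
    ((∀ x ∈ zeroLevel f, PosSectionalCurvatureAt f x) ↔
      ∀ x ∈ zeroLevel f, (HessPosDefAt f x ∨ HessNegDefAt f x)) ∧
    -- on a connected hypersurface the sign is the same at all points
    (IsPreconnected (zeroLevel f) →
      ((∀ x ∈ zeroLevel f, PosSectionalCurvatureAt f x) ↔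
        ((∀ x ∈ zeroLevel f, HessPosDefAt f x) ∨ (∀ x ∈ zeroLevel f, HessNegDefAt f x)))) := by
  have hpt : ∀ x ∈ zeroLevel f,
      (PosSectionalCurvatureAt f x ↔ (HessPosDefAt f x ∨ HessNegDefAt f x)) := fun x hx =>
    posSectionalCurvatureAt_iff hn hf hx (hreg x hx)
  have hall := forall₂_congr hpt
  refine ⟨fun x hx v hv w hw _ => ?_, fun x hx v hv w hw h1 h2 h3 => ?_, hpt, hall,
    fun hconn => hall.trans ⟨?_, ?_⟩⟩
  · obtain ⟨K, hK⟩ := exists_hasSectionalCurvature hf hx (hreg x hx) hv hw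
    exact ⟨K, hK, fun K' hK' =>
      (hK'.eq_hess hf (hreg x hx)).trans (hK.eq_hess hf (hreg x hx)).symm⟩
  · rw [sectionalCurvature_zeroLevel hf hx (hreg x hx) hv hw, h1, h2, h3]
    norm_num
  · exact forall_hessPosDefAt_or_forall_hessNegDefAt (by omega) hf hreg hconn
  · rintro (h | h) x hx
    · exact Or.inl (h x hx)
    · exact Or.inr (h x hx)
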